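/- **Setting.** Let $\mathcal H\subseteq\mathcal Y^{\mathcal X}$ be a non-empty hypothesis class; no assumption is made on the sizes of $\mathcal X$ and $\mathcal Y$. Its Littlestone dimension $\mathrm L(\mathcal H)\in\mathbb N\cup\{\infty\}$ is the largest $d$ for which there is a complete binary tree of depth $d$, with internal nodes labelled by examples in $\mathcal X$ and the two edges below each node labelled by two distinct elements of $\mathcal Y$, such that every root-to-leaf path is consistent with some $h\in\mathcal H$. An *offline learner* $\mathcal B$ is given a sequence $x_{1:n}$ in advance and then, for $t=1,\dots,n$, makes a randomized prediction of $y_t$ after having seen $y_1,\dots,y_{t-1}$. Its worst-case expected regret is $$\mathrm R_{\mathcal B}(n,\mathcal H)=\sup_{x_{1:n},\,y_{1:n}}\Big(\mathbb E\sum_{t=1}^n\mathbf 1\{\mathcal B_{x_{1:n}}(x_t)\ne y_t\}-\inf_{h\in\mathcal H}\sum_{t=1}^n\mathbf 1\{h(x_t)\neq y_t\}\Big),$$ and $\mathrm M_{\mathcal B}(n,\mathcal H)$ is its worst-case expected number of mistakes over sequences labelled by some $h\in\mathcal H$. $\mathcal B$ is *no-regret* if $\mathrm M_{\mathcal B}(n,\mathcal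 H)=o(n)$ or $\mathrm R_{\mathcal B}(n,\mathcal H)=o(n)$. A *Predictor* $\mathcal P$ with horizon $T$ outputs in each round $t$, after seeing $x_{1:t}$, a (possibly randomized) forecast $\hat x^t_{1:T}\in\mathcal X^T$. It is consistent ($\hat x^t_{1:t}=x_{1:t}$) and lazy (if $\hat x^{t-1}_t=x_t$ then $\hat x^t=\hat x^{t-1}$, for $t\ge 2$), and $\mathrm M_{\mathcal P}(x_{1:T})=\mathbb E\big[\sum_{t=2}^T\mathbf 1\{\hat x^{t-1}_t\ne x_t\}\big]$. An *online learner* with horizon $T$ makes in each round $t$ a randomized prediction of $y_t$ from $x_{1:t}$, $y_{1:t-1}$ and the forecasts $\hat x^1,\dots,\hat x^t$. Its expected regret on a stream is its expected number of mistakes (over the randomness of the learner and of $\mathcal P$) minus $\inf_{h\in\mathcal H}\sum_{t=1}^T\mathbf 1\{h(x_t)\ne y_t\}$. **Theorem (Agnostic upper bound).** For every such $\mathcal H$, every consistent and lazy Predictor $\mathcal P$ and every no-regret offline learner $\mathcal B$ (such that running $\mathcal B$ on the random forecasts of $\mathcal P$ is measurable), there is an online learner $\mathcal A$ such that, for every horizon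 $T\ge 1$, every stream $(x_1,y_1),\dots,(x_T,y_T)$ in $\mathcal X\times\mathcal Y$, and every concave function $\overline{\mathrm R}_{\mathcal B}(\cdot,\mathcal H):[0,\infty)\to[0,\infty)$ with $\mathrm R_{\mathcal B}(n,\mathcal H)\le\overline{\mathrm R}_{\mathcal B}(n,\mathcal H)$ for all $n\in\mathbb N$ (in particular for a concave sublinear one), the expected regret of $\mathcal A$ on the stream is at most $$\min\Big\{\sqrt{\mathrm L(\mathcal H)\,T\log_2(eT)},\;\; 2\big(\mathrm M_{\mathcal P}(x_{1:T})+1\big)\,\overline{\mathrm R}_{\mathcal B}\Big(\frac{T}{\mathrm M_{\mathcal P}(x_{1:T})+1}+1,\ \mathcal H\Big)+\sqrt{T\log_2T}\Big\}+\sqrt T ,$$ where the first term of the minimum is $+\infty$ if $\mathrm L(\mathcal H)=\infty$. -/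

import Mathlib

open MeasureTheory Filter Asymptotics

noncomputable section

/-! ## Littlestone dimension (multiclass) -/

/-- A Littlestone tree of depth `d`: a complete binary tree of depth `d` whose internal nodes carry
examples and in which the two edges leaving a node carry two different labels. -/
inductive LittlestoneTree (X : Type*) (Y : Type*) : ℕ → Type _ where
  | leaf : LittlestoneTree X Y 0
  | node {d : ℕ} (x : X) (label : Bool → Y) (hne : label false ≠ label true)
      (child : Bool → LittlestoneTree X Y d) : LittlestoneTree X Y (d + 1)

/-- `h` agrees with all the labelled examples met when walking down the tree along the path `σ`. -/
def LittlestoneTree.ShattersPath {X Y : Type*} (h : X → Y) :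
    {d : ℕ} → LittlestoneTree X Y d → (Fin d → Bool) → Prop
  | _, .leaf, _ => True
  | _, .node x label _ child, σ =>
      h x = label (σ 0) ∧ LittlestoneTree.ShattersPath h (child (σ 0)) (Fin.tail σ)

/-- Every root-to-leaf path is shattered by some hypothesis of the class. -/
def LittlestoneTree.IsShatteredBy {X Y : Type*} {d : ℕ} (τ : LittlestoneTree X Y d)
    (H : Set (X → Y)) : Prop :=
  ∀ σ : Fin d → Bool, ∃ h ∈ H, τ.ShattersPath h σ

/-- The largest depth of a shattered Littlestone tree, `⊤` if the depth is unbounded. -/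
def littlestoneDim {X Y : Type*} (H : Set (X → Y)) : ℕ∞ :=
  ⨆ (d : ℕ) (_ : ∃ τ : LittlestoneTree X Y d, τ.IsShatteredBy H), (d : ℕ∞)

/-! ## Streams -/

open Classical in
/-- Number of mistakes of the hypothesis `h` on the stream `(x₁, y₁), …, (xₙ, yₙ)`. -/
def hypothesisMistakes {X Y : Type*} {n : ℕ} (h : X → Y) (x : Fin n → X) (y : Fin n → Y) : ℕ :=
  (Finset.univ.filter fun t => h (x t) ≠ y t).card

/-- `inf_{h ∈ H} ∑ₜ 1{h(xₜ) ≠ yₜ}`. -/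
def bestInHindsight {X Y : Type*} {n : ℕ} (H : Set (X → Y)) (x : Fin n → X) (y : Fin n → Y) : ℝ :=
  ⨅ h : H, (hypothesisMistakes h.1 x y : ℝ)

/-! ## Offline (transductive) learners

A randomized learner is given by the law of its next prediction, as a function of everything that
has been revealed to it. For a fixed stream, the expected number of mistakes depends on these laws
only. Rounds are numbered `0, …, n - 1`. -/

/-- `B n x t y` is the law of the prediction for `x t` made by the offline learner that was
initialized with the sequence `x` of length `n` and has seen the labels `y` of the rounds before
`t`. -/
abbrev OfflineLearner (X Y : Type*) [MeasurableSpace Y] :=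
  (n : ℕ) → (Fin n → X) → (t : Fin n) → (Fin t → Y) → ProbabilityMeasure Y

/-- Expected number of mistakes of the offline learner on a stream. -/
def offlineMistakes {X Y : Type*} [MeasurableSpace Y] (B : OfflineLearner X Y) {n : ℕ}
    (x : Fin n → X) (y : Fin n → Y) : ℝ :=
  ∑ t : Fin n, (B n x t (Fin.take t t.isLt.le y) : Measure Y).real {c | c ≠ y t}

/-- `R_B(n, H)`: worst-case expected regret of the offline learner. -/
def offlineRegret {X Y : Type*} [MeasurableSpace Y] (B : OfflineLearner X Y) (H : Set (X → Y))
    (n : ℕ) : ℝ :=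
  ⨆ p : (Fin n → X) × (Fin n → Y), (offlineMistakes B p.1 p.2 - bestInHindsight H p.1 p.2)

/-- `M_B(n, H)`: worst-case expected number of mistakes on streams labelled by a hypothesis. -/
def offlineMistakeBound {X Y : Type*} [MeasurableSpace Y] (B : OfflineLearner X Y)
    (H : Set (X → Y)) (n : ℕ) : ℝ :=
  ⨆ p : H × (Fin n → X), offlineMistakes B p.2 (fun t => p.1.1 (p.2 t))

/-- The offline learner has sublinear worst-case mistakes or sublinear worst-case regret. -/
def IsNoRegret {X Y : Type*} [MeasurableSpace Y] (B : OfflineLearner X Y) (H : Set (X → Y)) :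
    Prop :=
  (fun n : ℕ => offlineMistakeBound B H n) =o[atTop] (fun n : ℕ => (n : ℝ)) ∨
    (fun n : ℕ => offlineRegret B H n) =o[atTop] (fun n : ℕ => (n : ℝ))

/-- `f : [0, ∞) → [0, ∞)` is concave and bounds the sequence `g` from above. Sublinearity of `f` is
not demanded, so that concave sublinear majorants are included as a special case. -/
structure IsConcaveMajorant (g : ℕ → ℝ) (f : ℝ → ℝ) : Prop where
  concave : ConcaveOn ℝ (Set.Ici 0) f
  nonneg : ∀ u, 0 ≤ u → 0 ≤ f u
  le : ∀ n : ℕ, g n ≤ f n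

/-! ## Predictors -/

/-- A randomized, consistent and lazy Predictor for the horizon `T`, with source of randomness
`(Ω, μ)`. After round `t` has revealed `x₀, …, xₜ`, it forecasts the whole sequence of length `T`. -/
structure Predictor {Ω : Type*} [MeasurableSpace Ω] (μ : Measure Ω) (X : Type*) (T : ℕ) where
  forecast : Ω → (t : Fin T) → (Fin (t + 1) → X) → (Fin T → X)
  measurableSet_correct : ∀ (x : Fin T → X) (s t : Fin T),
    MeasurableSet {ω | forecast ω s (Fin.take (s + 1) s.isLt x) t = x t}
  consistent : ∀ (x : Fin T → X) (s t : Fin T), t ≤ s →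
    ∀ᵐ ω ∂μ, forecast ω s (Fin.take (s + 1) s.isLt x) t = x t
  lazy : ∀ (x : Fin T → X) (s t : Fin T), (s : ℕ) + 1 = t →
    ∀ᵐ ω ∂μ, forecast ω s (Fin.take (s + 1) s.isLt x) t = x t →
      forecast ω t (Fin.take (t + 1) t.isLt x) = forecast ω s (Fin.take (s + 1) s.isLt x)

namespace Predictor

variable {Ω : Type*} [MeasurableSpace Ω] {μ : Measure Ω} {X : Type*} {T : ℕ}

/-- The forecast made in round `t` when the example stream is `x`. -/
def forecastOn (P : Predictor μ X T) (x : Fin T → X) (ω : Ω) (t : Fin T) : Fin T → X :=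
  P.forecast ω t (Fin.take (t + 1) t.isLt x)

open Classical in
/-- Number of rounds, other than the first, whose example was not forecast in the round before. -/
def mistakes (P : Predictor μ X T) (x : Fin T → X) (ω : Ω) : ℕ :=
  (Finset.univ.filter fun t : Fin T =>
    ∃ s : Fin T, (s : ℕ) + 1 = t ∧ P.forecastOn x ω s t ≠ x t).card

/-- `M_P(x₁, …, x_T)`: expected number of mistakes of the Predictor. -/
def expectedMistakes (P : Predictor μ X T) (x : Fin T → X) : ℝ :=
  ∫ ω, (P.mistakes x ω : ℝ) ∂μ

/-- Running the offline learner `B` on a stretch `s, …, s + n - 1` of the forecast made in round `s`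
is a well-defined random experiment: the probability that `B` predicts a given label is a measurable
function of the randomness of the Predictor. This holds automatically if the Predictor is
deterministic or if all subsets of `Ω` are measurable. -/
def IsMeasurableFor {Y : Type*} [MeasurableSpace Y] (P : Predictor μ X T)
    (B : OfflineLearner X Y) : Prop :=
  ∀ (x : Fin T → X) (s : Fin T) (n : ℕ) (hn : (s : ℕ) + n ≤ T) (t : Fin n) (y : Fin t → Y) (c : Y),
    Measurable fun ω =>
      (B n (fun i : Fin n => P.forecastOn x ω s ⟨s + i, by omega⟩) t y : Measure Y) {c}

end Predictor

/-! ## Online learners with a Predictor -/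

/-- `A t x y z` is the law of the prediction in round `t` after seeing the examples `x` of the
rounds up to `t`, the labels `y` of the earlier rounds, and the forecasts `z` that the Predictor
issued in the rounds up to `t`. -/
abbrev OnlineLearner (X Y : Type*) [MeasurableSpace Y] (T : ℕ) :=
  (t : Fin T) → (Fin (t + 1) → X) → (Fin t → Y) → (Fin (t + 1) → (Fin T → X)) →
    ProbabilityMeasure Y

/-- Expected number of mistakes on a stream, over the randomness of the learner, given the forecasts
`z` of all rounds. -/
def onlineMistakes {X Y : Type*} [MeasurableSpace Y] {T : ℕ} (A : OnlineLearner X Y T)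
    (x : Fin T → X) (y : Fin T → Y) (z : Fin T → (Fin T → X)) : ℝ :=
  ∑ t : Fin T, (A t (Fin.take (t + 1) t.isLt x) (Fin.take t t.isLt.le y)
    (Fin.take (t + 1) t.isLt z) : Measure Y).real {c | c ≠ y t}

/-- Expected regret on a stream, over the randomness of the learner and of the Predictor. -/
def expectedRegret {X Y Ω : Type*} [MeasurableSpace Y] [MeasurableSpace Ω] {μ : Measure Ω} {T : ℕ}
    (A : OnlineLearner X Y T) (P : Predictor μ X T) (H : Set (X → Y)) (x : Fin T → X)
    (y : Fin T → Y) : ℝ :=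
  (∫ ω, onlineMistakes A x y (P.forecastOn x ω) ∂μ) - bestInHindsight H x y

/-- `√(L · T · log₂(e T))`, which is infinite for `L = ∞`. -/
def littlestoneTerm (L : ℕ∞) (T : ℕ) : EReal :=
  match L with
  | ⊤ => ⊤
  | (d : ℕ) => ((√((d : ℝ) * T * Real.logb 2 (Real.exp 1 * T)) : ℝ) : EReal)

end

/-!
The learner mixes two learners by exponential weights, which costs at most `√(T log 2 / 2) ≤ √T`
against the better of the two (`onlineMistakes_hedge_le`, resting on Hoeffding's lemma).

The first one is itself a mixture, over the lists of at most `L` rounds, of experts that run the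
standard optimal algorithm and update it in the listed rounds only, with the labels revealed there.
Updating with the revealed labels is what makes the number of experts independent of the size of the
label space. Given `h ∈ H`, let the list consist of the rounds in which `h` is right and the
algorithm wrong. Each of these updates lowers the depth of the trees shattered by the version space,
which never loses `h`, so there are at most `L` of them (`card_update_rounds_le`), and the expert
makes at most `L` more mistakes than `h`. The list is coded by a map `Fin L → Fin (T + 1)`, so the
mixture costs `√(T L log (T + 1) / 2)`, and the additive `L` is absorbed by the slack between
natural and binary logarithms (`le_sqrt_mul_logb_add_sqrt`).

The second one is a mixture over the periods `k = 1, …, T` of experts that run the offline learner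
on the current forecast and restart it at each multiple of `k` and after each mistake of the
Predictor. Between two restarts a consistent and lazy Predictor keeps a forecast that is correct so far, so the
offline learner works on the true examples. A restart may cut its run short, but the regret on an
initial segment is still at most the regret for the planned length, because the labels may be
continued by those of the comparison hypothesis (`initial_excess_le_offlineRegret`). With `m`
mistakes of the Predictor there are at most `T / k + 1 + m` restarts, each with planned length at
most `k` (`onlineMistakes_restartExpert_le`). Taking `k = ⌈T / (M + 1)⌉` for the expected number `M`
of mistakes and integrating over the randomness of the Predictor gives, on average, at most
`2 (M + 1)` runs, each of length at most `T / (M + 1) + 1`. Of the concave majorant only its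
monotonicity is needed
(`ConcaveOn.monotoneOn_of_nonneg`).
-/

/-! ### Exponential weights -/

/-- Hoeffding's lemma for a finitely supported law with weights `p` and values in `[0, 1]`. -/
theorem sum_mul_exp_neg_le {ι : Type*} [Fintype ι] (p l : ι → ℝ) (hp : ∀ i, 0 ≤ p i)
    (hsum : ∑ i, p i = 1) (hl : ∀ i, l i ∈ Set.Icc (0 : ℝ) 1) (η : ℝ) :
    ∑ i, p i * Real.exp (-η * l i) ≤ Real.exp (-η * ∑ i, p i * l i + η ^ 2 / 8) := by
  let _ : MeasurableSpace ι := ⊤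
  let q : PMF ι := PMF.ofFintype (fun i => ENNReal.ofReal (p i)) (by
    rw [← ENNReal.ofReal_sum_of_nonneg fun i _ => hp i, hsum, ENNReal.ofReal_one])
  have hint : ∀ f : ι → ℝ, ∫ i, f i ∂q.toMeasure = ∑ i, p i * f i := fun f => by
    rw [PMF.integral_eq_sum]
    simp [q, ENNReal.toReal_ofReal (hp _)]
  have h := (ProbabilityTheory.hasSubgaussianMGF_of_mem_Icc (μ := q.toMeasure) (X := l)
    (measurable_of_countable l).aemeasurable (ae_of_all _ hl)).mgf_le (-η)
  simp only [ProbabilityTheory.mgf, hint] at h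
  set m := ∑ i, p i * l i
  have h1 : ∑ i, p i * Real.exp (-η * l i)
      = Real.exp (-η * m) * ∑ i, p i * Real.exp (-η * (l i - m)) := by
    rw [Finset.mul_sum]
    refine Finset.sum_congr rfl fun i _ => ?_
    rw [mul_left_comm, ← Real.exp_add]
    ring_nf
  rw [h1, Real.exp_add]
  refine mul_le_mul_of_nonneg_left (h.trans (le_of_eq ?_)) (Real.exp_nonneg _)
  congr 1
  simp
  ring

/-- The exponential-weights law over finitely many experts with cumulative losses `c`. -/
noncomputable def gibbsWeight {ι : Type*} [Fintype ι] (η : ℝ) (c : ι → ℝ) (i : ι) : ℝ :=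
  Real.exp (-η * c i) / ∑ j, Real.exp (-η * c j)

theorem gibbsWeight_nonneg {ι : Type*} [Fintype ι] (η : ℝ) (c : ι → ℝ) (i : ι) :
    0 ≤ gibbsWeight η c i := by unfold gibbsWeight; positivity

theorem sum_gibbsWeight {ι : Type*} [Fintype ι] [Nonempty ι] (η : ℝ) (c : ι → ℝ) :
    ∑ i, gibbsWeight η c i = 1 := by
  have : 0 < ∑ j, Real.exp (-η * c j) :=
    Finset.sum_pos (fun _ _ => Real.exp_pos _) Finset.univ_nonempty
  simp only [gibbsWeight]
  rw [← Finset.sum_div, div_self this.ne']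

/-- The potential argument for exponential weights: the normalizing constant decays exponentially in
the accumulated loss of the mixture, up to `η² / 8` per round in the exponent. -/
theorem sum_exp_cumulative_le {ι : Type*} [Fintype ι] [Nonempty ι] (η : ℝ) (l : ℕ → ι → ℝ)
    (hl : ∀ t i, l t i ∈ Set.Icc (0 : ℝ) 1) (T : ℕ) :
    ∑ i, Real.exp (-η * ∑ s ∈ Finset.range T, l s i) ≤
      Fintype.card ι * Real.exp (-η * (∑ t ∈ Finset.range T,
        ∑ i, gibbsWeight η (fun j => ∑ s ∈ Finset.range t, l s j) i * l t i) +
          T * (η ^ 2 / 8)) := by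
  induction T with
  | zero => simp
  | succ T ih =>
    set c : ι → ℝ := fun j => ∑ s ∈ Finset.range T, l s j with hc
    have hpos : 0 < ∑ j, Real.exp (-η * c j) :=
      Finset.sum_pos (fun _ _ => Real.exp_pos _) Finset.univ_nonempty
    have hstep := sum_mul_exp_neg_le (gibbsWeight η c) (l T) (gibbsWeight_nonneg η c)
      (sum_gibbsWeight η c) (hl T) η
    have h1 : ∑ i, Real.exp (-η * ∑ s ∈ Finset.range (T + 1), l s i)
        = (∑ j, Real.exp (-η * c j)) * ∑ i, gibbsWeight η c i * Real.exp (-η * l T i) := by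
      rw [Finset.mul_sum]
      refine Finset.sum_congr rfl fun i _ => ?_
      rw [Finset.sum_range_succ, mul_add, Real.exp_add, gibbsWeight]
      field_simp
      rfl
    rw [h1, Finset.sum_range_succ]
    calc _ ≤ _ := mul_le_mul ih hstep (by
            exact Finset.sum_nonneg fun i _ =>
              mul_nonneg (gibbsWeight_nonneg η c i) (Real.exp_nonneg _)) (by positivity)
      _ = _ := by
        rw [mul_assoc, ← Real.exp_add]
        congr 2
        push_cast
        ring

/-- The learning rate that balances the two terms of the regret bound of exponential weights. -/
noncomputable def hedgeRate (N T : ℕ) : ℝ := √(8 * Real.log N / T)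

theorem exponentialWeights_regret {ι : Type*} [Fintype ι] [Nonempty ι] (l : ℕ → ι → ℝ)
    (hl : ∀ t i, l t i ∈ Set.Icc (0 : ℝ) 1) (T : ℕ) (k : ι) :
    ∑ t ∈ Finset.range T, ∑ i, gibbsWeight (hedgeRate (Fintype.card ι) T)
        (fun j => ∑ s ∈ Finset.range t, l s j) i * l t i ≤
      ∑ t ∈ Finset.range T, l t k + √(T * Real.log (Fintype.card ι) / 2) := by
  rcases T.eq_zero_or_pos with rfl | hT
  · simp
  have hTpos : (0 : ℝ) < T := by exact_mod_cast hT
  rcases (Fintype.card ι).eq_zero_or_pos with h0 | hN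
  · exact absurd h0 Fintype.card_ne_zero
  rcases Nat.lt_or_ge 1 (Fintype.card ι) with hN1 | hN1
  · set N := Fintype.card ι
    set η := hedgeRate N T with hη
    have hlog : 0 < Real.log N := Real.log_pos (by exact_mod_cast hN1)
    have hηpos : 0 < η := Real.sqrt_pos.2 (by positivity)
    have hη2 : η ^ 2 = 8 * Real.log N / T := Real.sq_sqrt (by positivity)
    set S := ∑ t ∈ Finset.range T, ∑ i, gibbsWeight η
        (fun j => ∑ s ∈ Finset.range t, l s j) i * l t i
    have h := (Finset.single_le_sum (f := fun i => Real.exp (-η * ∑ s ∈ Finset.range T, l s i))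
      (fun i _ => Real.exp_nonneg _) (Finset.mem_univ k)).trans (sum_exp_cumulative_le η l hl T)
    have h2 := Real.log_le_log (Real.exp_pos _) h
    rw [Real.log_mul (by positivity) (Real.exp_pos _).ne', Real.log_exp, Real.log_exp] at h2
    set C := ∑ s ∈ Finset.range T, l s k
    -- The rate is chosen such that `log N = η² T / 8` and `√(T log N / 2) = η T / 4`.
    have h3 : Real.log N = η ^ 2 * T / 8 := by rw [hη2]; field_simp
    have h4 : √(T * Real.log N / 2) = η * T / 4 := by
      rw [h3, show (T * (η ^ 2 * T / 8) / 2 : ℝ) = (η * T / 4) ^ 2 by ring,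
        Real.sqrt_sq (by positivity)]
    rw [h4]
    have h5 : η * S ≤ η * (C + η * T / 4) := by nlinarith
    exact le_of_mul_le_mul_left h5 hηpos
  · have hss : Subsingleton ι := Fintype.card_le_one_iff_subsingleton.1 hN1
    have hu : ∀ f : ι → ℝ, ∑ i, f i = f k := fun f =>
      Fintype.sum_eq_single k fun j hj => absurd (Subsingleton.elim j k) hj
    have h : ∀ t, ∑ i, gibbsWeight (hedgeRate (Fintype.card ι) T)
        (fun j => ∑ s ∈ Finset.range t, l s j) i * l t i = l t k := fun t => by
      have h1 := sum_gibbsWeight (hedgeRate (Fintype.card ι) T)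
        (fun j => ∑ s ∈ Finset.range t, l s j)
      rw [hu] at h1 ⊢
      rw [h1, one_mul]
    simp only [h]
    linarith [Real.sqrt_nonneg (T * Real.log (Fintype.card ι) / 2)]

/-! ### Mixtures of online learners -/

section Hedge

variable {X Y : Type*} [MeasurableSpace Y] {T : ℕ}

/-- Probability of a mistake in round `t`. -/
noncomputable def roundLoss (A : OnlineLearner X Y T) (x : Fin T → X) (y : Fin T → Y)
    (z : Fin T → (Fin T → X)) (t : Fin T) : ℝ :=
  (A t (Fin.take (t + 1) t.isLt x) (Fin.take t t.isLt.le y)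
    (Fin.take (t + 1) t.isLt z) : Measure Y).real {c | c ≠ y t}

theorem roundLoss_mem_Icc (A : OnlineLearner X Y T) (x : Fin T → X) (y : Fin T → Y)
    (z : Fin T → (Fin T → X)) (t : Fin T) : roundLoss A x y z t ∈ Set.Icc (0 : ℝ) 1 :=
  ⟨measureReal_nonneg, measureReal_le_one⟩

theorem onlineMistakes_eq_sum (A : OnlineLearner X Y T) (x : Fin T → X) (y : Fin T → Y)
    (z : Fin T → (Fin T → X)) : onlineMistakes A x y z = ∑ t, roundLoss A x y z t := rfl

theorem onlineMistakes_le (A : OnlineLearner X Y T) (x : Fin T → X) (y : Fin T → Y)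
    (z : Fin T → (Fin T → X)) : onlineMistakes A x y z ≤ T := by
  rw [onlineMistakes_eq_sum]
  simpa using Finset.sum_le_sum fun t (_ : t ∈ Finset.univ) => (roundLoss_mem_Icc A x y z t).2

theorem onlineMistakes_nonneg (A : OnlineLearner X Y T) (x : Fin T → X) (y : Fin T → Y)
    (z : Fin T → (Fin T → X)) : 0 ≤ onlineMistakes A x y z :=
  Finset.sum_nonneg fun t _ => (roundLoss_mem_Icc A x y z t).1

/-- Expected number of mistakes in the rounds before `t`, as a function of what is known in
round `t`. -/
noncomputable def pastLoss (A : OnlineLearner X Y T) (t : Fin T) (x : Fin (t + 1) → X)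
    (y : Fin t → Y) (z : Fin (t + 1) → (Fin T → X)) : ℝ :=
  ∑ s : Fin t, (A ⟨s, s.isLt.trans t.isLt⟩
    (Fin.take (s + 1) (by omega) x) (Fin.take s s.isLt.le y) (Fin.take (s + 1) (by omega) z) :
      Measure Y).real {c | c ≠ y s}

/-- The mixture of finitely many laws with given convex weights. -/
noncomputable def mixture {ι : Type*} [Fintype ι] (p : ι → ℝ) (hp : ∀ i, 0 ≤ p i)
    (hsum : ∑ i, p i = 1) (ν : ι → ProbabilityMeasure Y) : ProbabilityMeasure Y :=
  ⟨∑ i, ENNReal.ofReal (p i) • (ν i : Measure Y), ⟨by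
    simp [← ENNReal.ofReal_sum_of_nonneg fun i _ => hp i, hsum]⟩⟩

theorem mixture_real {ι : Type*} [Fintype ι] (p : ι → ℝ) (hp : ∀ i, 0 ≤ p i)
    (hsum : ∑ i, p i = 1) (ν : ι → ProbabilityMeasure Y) (s : Set Y) :
    (mixture p hp hsum ν : Measure Y).real s = ∑ i, p i * (ν i : Measure Y).real s := by
  have : (mixture p hp hsum ν : Measure Y) = ∑ i, ENNReal.ofReal (p i) • (ν i : Measure Y) := rfl
  rw [this, Measure.real, Measure.finsetSum_apply, ENNReal.toReal_sum fun i _ => by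
    rw [Measure.smul_apply, smul_eq_mul]; finiteness]
  simp [ENNReal.toReal_ofReal (hp _), Measure.real]

/-- The randomized learner that follows expert `i` with the exponential weight of its past
losses. -/
noncomputable def hedge {ι : Type*} [Fintype ι] [Nonempty ι] (E : ι → OnlineLearner X Y T) :
    OnlineLearner X Y T := fun t x y z =>
  mixture (gibbsWeight (hedgeRate (Fintype.card ι) T) fun i => pastLoss (E i) t x y z)
    (gibbsWeight_nonneg _ _) (sum_gibbsWeight _ _) fun i => E i t x y z

theorem roundLoss_hedge {ι : Type*} [Fintype ι] [Nonempty ι] (E : ι → OnlineLearner X Y T)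
    (x : Fin T → X) (y : Fin T → Y) (z : Fin T → (Fin T → X)) (t : Fin T) :
    roundLoss (hedge E) x y z t = ∑ i, gibbsWeight (hedgeRate (Fintype.card ι) T)
      (fun j => ∑ s : Fin t, roundLoss (E j) x y z ⟨s, s.isLt.trans t.isLt⟩) i
        * roundLoss (E i) x y z t := by
  rw [roundLoss, hedge, mixture_real]
  rfl

theorem onlineMistakes_hedge_le {ι : Type*} [Fintype ι] [Nonempty ι] (E : ι → OnlineLearner X Y T)
    (x : Fin T → X) (y : Fin T → Y) (z : Fin T → (Fin T → X)) (k : ι) :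
    onlineMistakes (hedge E) x y z ≤
      onlineMistakes (E k) x y z + √(T * Real.log (Fintype.card ι) / 2) := by
  let l : ℕ → ι → ℝ := fun t i => if h : t < T then roundLoss (E i) x y z ⟨t, h⟩ else 0
  have hl : ∀ t i, l t i ∈ Set.Icc (0 : ℝ) 1 := fun t i => by
    by_cases h : t < T
    · simpa [l, h] using roundLoss_mem_Icc (E i) x y z ⟨t, h⟩
    · simp [l, h]
  have hlt : ∀ (t : Fin T) i, l t i = roundLoss (E i) x y z t := fun t i => by simp [l]
  have h := exponentialWeights_regret l hl T k
  rw [Finset.sum_range, Finset.sum_range] at h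
  rw [onlineMistakes_eq_sum, onlineMistakes_eq_sum]
  refine le_of_eq_of_le (Finset.sum_congr rfl fun t _ => ?_) (h.trans_eq ?_)
  · rw [roundLoss_hedge]
    simp only [Finset.sum_range, hlt]
    refine Finset.sum_congr rfl fun i _ => ?_
    congr 2
    exact funext fun j =>
      Finset.sum_congr rfl fun s _ => (hlt ⟨s, s.isLt.trans t.isLt⟩ j).symm
  · simp only [hlt]

variable {Ω : Type*} [MeasurableSpace Ω]

theorem measurable_gibbsWeight {ι : Type*} [Fintype ι] (η : ℝ) (c : Ω → ι → ℝ)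
    (hc : ∀ i, Measurable fun ω => c ω i) (i : ι) :
    Measurable fun ω => gibbsWeight η (c ω) i := by
  unfold gibbsWeight
  have := hc i
  fun_prop

theorem measurable_roundLoss_hedge {ι : Type*} [Fintype ι] [Nonempty ι]
    (E : ι → OnlineLearner X Y T) (x : Fin T → X) (y : Fin T → Y) (z : Ω → Fin T → (Fin T → X))
    (hE : ∀ i t, Measurable fun ω => roundLoss (E i) x y (z ω) t) (t : Fin T) :
    Measurable fun ω => roundLoss (hedge E) x y (z ω) t := by
  simp only [roundLoss_hedge]
  refine Finset.measurable_sum _ fun i _ => Measurable.mul ?_ (hE i t)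
  exact measurable_gibbsWeight _
    (fun ω j => ∑ s : Fin t, roundLoss (E j) x y (z ω) ⟨s, s.isLt.trans t.isLt⟩)
    (fun j => Finset.measurable_sum _ fun s _ => hE j _) i

theorem integrable_onlineMistakes (μ : Measure Ω) [IsProbabilityMeasure μ]
    (A : OnlineLearner X Y T) (x : Fin T → X) (y : Fin T → Y) (z : Ω → Fin T → (Fin T → X))
    (hA : ∀ t, Measurable fun ω => roundLoss A x y (z ω) t) :
    Integrable (fun ω => onlineMistakes A x y (z ω)) μ :=
  Integrable.of_mem_Icc 0 T (Finset.measurable_sum _ fun t _ => hA t).aemeasurable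
    (ae_of_all _ fun _ => ⟨onlineMistakes_nonneg _ _ _ _, onlineMistakes_le _ _ _ _⟩)

end Hedge

/-! ### The standard optimal algorithm and its experts -/

section StandardOptimal

variable {X Y : Type*}

/-- Some Littlestone tree of depth `d` is shattered by `V`. In contrast to `littlestoneDim`, this
distinguishes the empty class, which shatters nothing, from the classes of dimension zero. -/
def ShattersDepth (V : Set (X → Y)) (d : ℕ) : Prop :=
  ∃ τ : LittlestoneTree X Y d, τ.IsShatteredBy V

theorem shattersDepth_zero {V : Set (X → Y)} {h : X → Y} (hV : h ∈ V) : ShattersDepth V 0 :=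
  ⟨.leaf, fun _ => ⟨h, hV, trivial⟩⟩

theorem not_shattersDepth_succ {H : Set (X → Y)} {L : ℕ} (hL : littlestoneDim H = L) :
    ¬ ShattersDepth H (L + 1) := fun h => by
  have h1 : ((L + 1 : ℕ) : ℕ∞) ≤ littlestoneDim H :=
    le_iSup₂ (f := fun (d : ℕ) (_ : ∃ τ : LittlestoneTree X Y d, τ.IsShatteredBy H) => (d : ℕ∞))
      (L + 1) h
  rw [hL] at h1
  exact absurd (Nat.cast_le.1 h1) (by omega)

/-- At most one label keeps the Littlestone dimension from dropping. -/
theorem label_unique_of_not_shattersDepth {V : Set (X → Y)} {d : ℕ} (hV : ¬ ShattersDepth V (d + 1))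
    {x : X} {y y' : Y} (h : ShattersDepth {g ∈ V | g x = y} d)
    (h' : ShattersDepth {g ∈ V | g x = y'} d) : y = y' := by
  by_contra hne
  obtain ⟨τ, hτ⟩ := h
  obtain ⟨τ', hτ'⟩ := h'
  refine hV ⟨.node x (fun b => if b then y' else y) (by simpa using hne)
    (fun b => if b then τ' else τ), fun σ => ?_⟩
  cases hσ : σ 0 with
  | true =>
    obtain ⟨g, ⟨hg, hgx⟩, hs⟩ := hτ' (Fin.tail σ)
    exact ⟨g, hg, by simpa [LittlestoneTree.ShattersPath, hσ] using ⟨hgx, hs⟩⟩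
  | false =>
    obtain ⟨g, ⟨hg, hgx⟩, hs⟩ := hτ (Fin.tail σ)
    exact ⟨g, hg, by simpa [LittlestoneTree.ShattersPath, hσ] using ⟨hgx, hs⟩⟩

/-- The hypotheses of `H` that agree with the stream in the rounds of `J` before `t`. -/
def versionSpace (H : Set (X → Y)) (J : Finset ℕ) {T : ℕ} (x : Fin T → X) (y : Fin T → Y) (t : ℕ) :
    Set (X → Y) :=
  {h ∈ H | ∀ s : Fin T, (s : ℕ) < t → (s : ℕ) ∈ J → h (x s) = y s}

/-- Prediction of the standard optimal algorithm for a class of Littlestone dimension `L` after an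
update in each round of `J` before `t`: a label under which the restricted version space still
shatters a tree of the depth reached by `L` minus the number of updates, if there is one. -/
noncomputable def soaLabel [Nonempty Y] (H : Set (X → Y)) (L : ℕ) (J : Finset ℕ) {t : ℕ}
    (x : Fin (t + 1) → X) (y : Fin t → Y) : Y :=
  Classical.epsilon fun c => ShattersDepth
    {h ∈ {h ∈ H | ∀ s : Fin t, (s : ℕ) ∈ J → h (x s.castSucc) = y s} | h (x (Fin.last t)) = c}
    (L - (J.filter (· < t)).card)

theorem soaLabel_take [Nonempty Y] (H : Set (X → Y)) (L : ℕ) (J : Finset ℕ) {T : ℕ} (x : Fin T → X)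
    (y : Fin T → Y) (t : Fin T) :
    soaLabel H L J (Fin.take (t + 1) t.isLt x) (Fin.take t t.isLt.le y) =
      Classical.epsilon fun c => ShattersDepth {h ∈ versionSpace H J x y t | h (x t) = c}
        (L - (J.filter (· < (t : ℕ))).card) := by
  have hV : {h ∈ H | ∀ s : Fin t, (s : ℕ) ∈ J → h (Fin.take (t + 1) t.isLt x s.castSucc) =
      Fin.take t t.isLt.le y s} = versionSpace H J x y t := by
    ext h
    refine and_congr_right fun _ => ⟨fun hs s hst hsJ => hs ⟨s, hst⟩ hsJ, fun hs s hsJ => ?_⟩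
    exact hs ⟨s, s.isLt.trans t.isLt⟩ s.isLt hsJ
  rw [soaLabel, hV]
  rfl

theorem soaLabel_congr [Nonempty Y] (H : Set (X → Y)) (L : ℕ) {J J' : Finset ℕ} {t : ℕ}
    (hJ : ∀ s < t, s ∈ J ↔ s ∈ J') (x : Fin (t + 1) → X) (y : Fin t → Y) :
    soaLabel H L J x y = soaLabel H L J' x y := by
  have h1 : J.filter (· < t) = J'.filter (· < t) := by
    ext s
    simp only [Finset.mem_filter, and_congr_left_iff]
    exact hJ s
  have h2 : ∀ s : Fin t, (s : ℕ) ∈ J ↔ (s : ℕ) ∈ J' := fun s => hJ s s.isLt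
  simp only [soaLabel, h1, h2]

/-- For every hypothesis there is a set of update rounds that consists of exactly the rounds in
which the hypothesis is correct but the algorithm is not. -/
theorem exists_update_rounds [Nonempty Y] (H : Set (X → Y)) (L : ℕ) {T : ℕ} (x : Fin T → X)
    (y : Fin T → Y) (h : X → Y) :
    ∃ J ⊆ Finset.range T, ∀ t : Fin T, (t : ℕ) ∈ J ↔ h (x t) = y t ∧
      soaLabel H L J (Fin.take (t + 1) t.isLt x) (Fin.take t t.isLt.le y) ≠ y t := by
  suffices hs : ∀ n ≤ T, ∃ J ⊆ Finset.range n, ∀ t : Fin T, (t : ℕ) < n → ((t : ℕ) ∈ J ↔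
      h (x t) = y t ∧
        soaLabel H L J (Fin.take (t + 1) t.isLt x) (Fin.take t t.isLt.le y) ≠ y t) by
    obtain ⟨J, hJ, hJ'⟩ := hs T le_rfl
    exact ⟨J, hJ, fun t => hJ' t t.isLt⟩
  intro n
  induction n with
  | zero => exact fun _ => ⟨∅, by simp, fun t ht => absurd ht (Nat.not_lt_zero _)⟩
  | succ n ih =>
    intro hn
    obtain ⟨J, hJ, hJ'⟩ := ih (by omega)
    have hlt : ∀ s ∈ J, s < n := fun s hs => Finset.mem_range.1 (hJ hs)
    classical
    let t₀ : Fin T := ⟨n, hn⟩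
    by_cases hc : h (x t₀) = y t₀ ∧
        soaLabel H L J (Fin.take (t₀ + 1) t₀.isLt x) (Fin.take t₀ t₀.isLt.le y) ≠ y t₀
    · refine ⟨insert n J, fun s hs => ?_, fun t ht => ?_⟩
      · rcases Finset.mem_insert.1 hs with rfl | hs
        · simp
        · exact Finset.mem_range.2 ((hlt s hs).trans (Nat.lt_succ_self n))
      · rw [soaLabel_congr (J' := J) H L (fun s hs => by
          simp only [Finset.mem_insert, or_iff_right_iff_imp]; omega)]
        rcases Nat.lt_succ_iff_lt_or_eq.1 ht with htn | htn
        · rw [← hJ' t htn, Finset.mem_insert, or_iff_right htn.ne]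
        · obtain rfl : t = t₀ := Fin.ext htn
          exact iff_of_true (Finset.mem_insert_self _ _) hc
    · refine ⟨J, hJ.trans (Finset.range_subset_range.2 n.le_succ), fun t ht => ?_⟩
      rcases Nat.lt_succ_iff_lt_or_eq.1 ht with htn | htn
      · exact hJ' t htn
      · obtain rfl : t = t₀ := Fin.ext htn
        exact iff_of_false (fun hm => (hlt _ hm).ne rfl) hc

/-- The mistake bound of the standard optimal algorithm: each update that corrects a mistake lowers
the depth of the trees shattered by the version space. -/
theorem card_update_rounds_le [Nonempty Y] {H : Set (X → Y)} {L : ℕ}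
    (hL : ¬ ShattersDepth H (L + 1)) {T : ℕ} (x : Fin T → X) (y : Fin T → Y) {h : X → Y}
    (hH : h ∈ H) {J : Finset ℕ} (hJT : J ⊆ Finset.range T)
    (hJ : ∀ t : Fin T, (t : ℕ) ∈ J → h (x t) = y t ∧
      soaLabel H L J (Fin.take (t + 1) t.isLt x) (Fin.take t t.isLt.le y) ≠ y t) :
    J.card ≤ L := by
  have hmem : ∀ t, h ∈ versionSpace H J x y t := fun t => ⟨hH, fun s _ hs => (hJ s hs).1⟩
  have hle : ∀ {V : Set (X → Y)} {c : ℕ}, h ∈ V → ¬ ShattersDepth V (L + 1 - c) → c ≤ L := by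
    intro V c hV hc
    by_contra hlt
    rw [Nat.sub_eq_zero_of_le (by omega)] at hc
    exact hc (shattersDepth_zero hV)
  have key : ∀ t ≤ T,
      ¬ ShattersDepth (versionSpace H J x y t) (L + 1 - (J.filter (· < t)).card) := by
    intro t
    induction t with
    | zero => simpa [versionSpace] using hL
    | succ t ih =>
      intro ht
      have ih := ih (by omega)
      by_cases htJ : t ∈ J
      · have hc := hle (hmem t) ih
        have hcard : (J.filter (· < t + 1)).card = (J.filter (· < t)).card + 1 := by
          rw [← Finset.card_insert_of_notMem (a := t) (by simp)]
          congr 1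
          ext s
          simp only [Finset.mem_filter, Finset.mem_insert]
          constructor
          · rintro ⟨h1, h2⟩
            rcases Nat.lt_succ_iff_lt_or_eq.1 h2 with h3 | h3
            exacts [Or.inr ⟨h1, h3⟩, Or.inl h3]
          · rintro (rfl | ⟨h1, h2⟩)
            exacts [⟨htJ, by omega⟩, ⟨h1, by omega⟩]
        obtain ⟨-, hne⟩ := hJ ⟨t, ht⟩ htJ
        have hsub : versionSpace H J x y (t + 1) =
            {g ∈ versionSpace H J x y t | g (x ⟨t, ht⟩) = y ⟨t, ht⟩} := by
          ext g
          constructor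
          · exact fun hg => ⟨⟨hg.1, fun s hs => hg.2 s (by omega)⟩,
              hg.2 ⟨t, ht⟩ (Nat.lt_succ_self t) htJ⟩
          · rintro ⟨hg, hgt⟩
            refine ⟨hg.1, fun s hs hsJ => ?_⟩
            rcases Nat.lt_succ_iff_lt_or_eq.1 hs with h3 | h3
            · exact hg.2 s h3 hsJ
            · obtain rfl : s = ⟨t, ht⟩ := Fin.ext h3
              exact hgt
        rw [hcard, hsub, show L + 1 - ((J.filter (· < t)).card + 1) =
          L - (J.filter (· < t)).card by omega]
        intro hs
        rw [show L + 1 - (J.filter (· < t)).card = L - (J.filter (· < t)).card + 1 by omega] at ih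
        rw [soaLabel_take] at hne
        exact hne (label_unique_of_not_shattersDepth ih (Classical.epsilon_spec
          (p := fun c => ShattersDepth {g ∈ versionSpace H J x y t | g (x ⟨t, ht⟩) = c}
            (L - (J.filter (· < t)).card)) ⟨_, hs⟩) hs)
      · have h1 : J.filter (· < t + 1) = J.filter (· < t) := by
          ext s
          simp only [Finset.mem_filter, and_congr_right_iff]
          refine fun hs => ⟨fun h2 => ?_, fun h2 => by omega⟩
          rcases Nat.lt_succ_iff_lt_or_eq.1 h2 with h3 | h3
          exacts [h3, absurd (h3 ▸ hs) htJ]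
        have h2 : versionSpace H J x y (t + 1) = versionSpace H J x y t := by
          ext g
          refine and_congr_right fun _ => ⟨fun hg s hs => hg s (by omega), fun hg s hs hsJ => ?_⟩
          rcases Nat.lt_succ_iff_lt_or_eq.1 hs with h3 | h3
          exacts [hg s h3 hsJ, absurd (h3 ▸ hsJ) htJ]
        rwa [h1, h2]
  have := hle (hmem T) (key T le_rfl)
  rwa [Finset.filter_true_of_mem fun s hs => Finset.mem_range.1 (hJT hs)] at this

variable [MeasurableSpace Y]

/-- The deterministic expert that runs the standard optimal algorithm and updates it with the
revealed label in the rounds of `J` only. -/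
noncomputable def soaExpert [Nonempty Y] (H : Set (X → Y)) (L T : ℕ) (J : Finset ℕ) :
    OnlineLearner X Y T :=
  fun _ x y _ => diracProba (soaLabel H L J x y)

open Classical in
theorem roundLoss_soaExpert [MeasurableSingletonClass Y] [Nonempty Y] (H : Set (X → Y)) (L : ℕ)
    {T : ℕ} (J : Finset ℕ) (x : Fin T → X) (y : Fin T → Y) (z : Fin T → (Fin T → X)) (t : Fin T) :
    roundLoss (soaExpert H L T J) x y z t =
      if soaLabel H L J (Fin.take (t + 1) t.isLt x) (Fin.take t t.isLt.le y) ≠ y t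
        then 1 else 0 := by
  rw [roundLoss, soaExpert, Measure.real]
  rw [show ∀ c : Y, (diracProba c : Measure Y) = Measure.dirac c from fun _ => rfl,
    Measure.dirac_apply' _ (show MeasurableSet {c | c ≠ y t} from
    (measurableSet_singleton (y t)).compl)]
  split_ifs with h
  · simp [Set.indicator, h]
  · rw [not_not] at h
    simp [Set.indicator, h]

/-- The lists of at most `L` update rounds are coded by the maps `Fin L → Fin (T + 1)`, the value
`T` standing for no update. -/
theorem exists_code_of_card_le {J : Finset ℕ} {L T : ℕ} (hJ : J ⊆ Finset.range T)
    (hc : J.card ≤ L) :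
    ∃ f : Fin L → Fin (T + 1), ∀ s < T, s ∈ Finset.univ.image (fun i => (f i : ℕ)) ↔ s ∈ J := by
  have hlt : ∀ s ∈ J, s < T := fun s hs => Finset.mem_range.1 (hJ hs)
  refine ⟨fun i => if h : (i : ℕ) < J.card then
    ⟨J.equivFin.symm ⟨i, h⟩, (hlt _ (J.equivFin.symm ⟨i, h⟩).2).trans (Nat.lt_succ_self T)⟩
    else Fin.last T, fun s hs => ?_⟩
  simp only [Finset.mem_image, Finset.mem_univ, true_and]
  constructor
  · rintro ⟨i, rfl⟩
    split_ifs at hs ⊢ with h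
    · exact (J.equivFin.symm ⟨i, h⟩).2
    · exact absurd hs (lt_irrefl _)
  · intro hsJ
    refine ⟨⟨J.equivFin ⟨s, hsJ⟩, (J.equivFin ⟨s, hsJ⟩).isLt.trans_le hc⟩, ?_⟩
    simp

/-- The experts of `soaLearner` together simulate, up to `L` mistakes, every hypothesis. -/
theorem exists_soaExpert_le [MeasurableSingletonClass Y] [Nonempty Y] {H : Set (X → Y)} {L : ℕ}
    (hL : ¬ ShattersDepth H (L + 1)) {T : ℕ} (x : Fin T → X) (y : Fin T → Y)
    (z : Fin T → (Fin T → X)) {h : X → Y} (hH : h ∈ H) :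
    ∃ f : Fin L → Fin (T + 1),
      onlineMistakes (soaExpert H L T (Finset.univ.image fun i => (f i : ℕ))) x y z ≤
        hypothesisMistakes h x y + L := by
  classical
  obtain ⟨J, hJT, hJ⟩ := exists_update_rounds H L x y h
  have hc := card_update_rounds_le hL x y hH hJT fun t ht => (hJ t).1 ht
  obtain ⟨f, hf⟩ := exists_code_of_card_le hJT hc
  refine ⟨f, ?_⟩
  rw [onlineMistakes_eq_sum]
  simp only [roundLoss_soaExpert]
  rw [Finset.sum_congr rfl fun t _ => by
    rw [soaLabel_congr (J' := J) H L fun s hs => hf s (hs.trans t.isLt)]]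
  rw [Finset.sum_boole]
  have hcJ : (Finset.univ.filter fun t : Fin T => (t : ℕ) ∈ J).card ≤ J.card :=
    Finset.card_le_card_of_injOn (fun t => (t : ℕ)) (fun t ht => by simpa using ht)
      fun a _ b _ hab => Fin.ext hab
  have hsub : (Finset.univ.filter fun t : Fin T => soaLabel H L J (Fin.take (t + 1) t.isLt x)
      (Fin.take t t.isLt.le y) ≠ y t) ⊆ (Finset.univ.filter fun t => h (x t) ≠ y t) ∪
        Finset.univ.filter fun t : Fin T => (t : ℕ) ∈ J := by
    intro t ht
    rw [Finset.mem_filter] at ht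
    by_cases hxy : h (x t) = y t
    · exact Finset.mem_union_right _ (Finset.mem_filter.2 ⟨Finset.mem_univ _, (hJ t).2 ⟨hxy, ht.2⟩⟩)
    · exact Finset.mem_union_left _ (Finset.mem_filter.2 ⟨Finset.mem_univ _, hxy⟩)
  have h3 := (Finset.card_le_card hsub).trans (Finset.card_union_le _ _)
  have h4 : (Finset.univ.filter fun t => h (x t) ≠ y t).card = hypothesisMistakes h x y := by
    unfold hypothesisMistakes
    congr
  exact_mod_cast h3.trans (by omega)

/-- Agnostic learner for a class of Littlestone dimension `L`. -/
noncomputable def soaLearner [Nonempty Y] (H : Set (X → Y)) (L T : ℕ) : OnlineLearner X Y T :=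
  hedge fun f : Fin L → Fin (T + 1) => soaExpert H L T (Finset.univ.image fun i => (f i : ℕ))

theorem onlineMistakes_soaLearner_le [MeasurableSingletonClass Y] [Nonempty Y] {H : Set (X → Y)}
    {L : ℕ} (hL : ¬ ShattersDepth H (L + 1)) {T : ℕ} (x : Fin T → X) (y : Fin T → Y)
    (z : Fin T → (Fin T → X)) {h : X → Y} (hH : h ∈ H) :
    onlineMistakes (soaLearner H L T) x y z ≤
      hypothesisMistakes h x y + L + √(T * (L * Real.log (T + 1)) / 2) := by
  obtain ⟨f, hf⟩ := exists_soaExpert_le hL x y z hH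
  refine (onlineMistakes_hedge_le _ x y z f).trans ?_
  have : Real.log (Fintype.card (Fin L → Fin (T + 1))) = L * Real.log (T + 1) := by simp
  rw [this]
  gcongr

theorem measurable_roundLoss_soaLearner [MeasurableSingletonClass Y] [Nonempty Y] {Ω : Type*}
    [MeasurableSpace Ω] (H : Set (X → Y)) (L : ℕ) {T : ℕ} (x : Fin T → X) (y : Fin T → Y)
    (z : Ω → Fin T → (Fin T → X)) (t : Fin T) :
    Measurable fun ω => roundLoss (soaLearner H L T) x y (z ω) t :=
  measurable_roundLoss_hedge _ x y z (fun f t => by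
    simp only [roundLoss_soaExpert]
    exact measurable_const) t

end StandardOptimal

/-! ### Offline learners on truncated sequences -/

section Offline

variable {X Y : Type*}

theorem bestInHindsight_nonneg (H : Set (X → Y)) {n : ℕ} (x : Fin n → X) (y : Fin n → Y) :
    0 ≤ bestInHindsight H x y := Real.iInf_nonneg fun _ => Nat.cast_nonneg _

theorem bestInHindsight_le {H : Set (X → Y)} {h : X → Y} (hH : h ∈ H) {n : ℕ} (x : Fin n → X)
    (y : Fin n → Y) : bestInHindsight H x y ≤ hypothesisMistakes h x y :=
  ciInf_le (f := fun h : H => (hypothesisMistakes h.1 x y : ℝ))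
    ⟨0, by rintro _ ⟨_, rfl⟩; exact Nat.cast_nonneg _⟩ ⟨h, hH⟩

variable [MeasurableSpace Y]

theorem offlineMistakes_le (B : OfflineLearner X Y) {n : ℕ} (x : Fin n → X) (y : Fin n → Y) :
    offlineMistakes B x y ≤ n := by
  unfold offlineMistakes
  simpa using Finset.sum_le_sum fun t (_ : t ∈ Finset.univ) =>
    measureReal_le_one (μ := (B n x t (Fin.take t t.isLt.le y) : Measure Y)) (s := {c | c ≠ y t})

theorem sub_bestInHindsight_le_offlineRegret (B : OfflineLearner X Y) (H : Set (X → Y)) {n : ℕ}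
    (x : Fin n → X) (y : Fin n → Y) :
    offlineMistakes B x y - bestInHindsight H x y ≤ offlineRegret B H n :=
  le_ciSup (f := fun p : (Fin n → X) × (Fin n → Y) =>
    offlineMistakes B p.1 p.2 - bestInHindsight H p.1 p.2)
    ⟨n, by
      rintro _ ⟨p, rfl⟩
      have h1 := offlineMistakes_le B p.1 p.2
      have h2 := bestInHindsight_nonneg H p.1 p.2
      simp only
      linarith⟩ (x, y)

open Classical in
/-- The regret of an offline learner with respect to `h` on an initial segment `D` of its input is
at most its regret for the whole length: continue the labels by those of `h`. -/
theorem initial_excess_le_offlineRegret (B : OfflineLearner X Y) {H : Set (X → Y)} {h : X → Y}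
    (hH : h ∈ H) {n : ℕ} (x : Fin n → X) (y : Fin n → Y) (D : Finset (Fin n))
    (hD : ∀ i j, i ≤ j → j ∈ D → i ∈ D) :
    ∑ j ∈ D, ((B n x j (Fin.take j j.isLt.le y) : Measure Y).real {c | c ≠ y j} -
      if h (x j) ≠ y j then 1 else 0) ≤ offlineRegret B H n := by
  let y' : Fin n → Y := fun j => if j ∈ D then y j else h (x j)
  have hy : ∀ j ∈ D, y' j = y j := fun j hj => if_pos hj
  have htake : ∀ j ∈ D, Fin.take j j.isLt.le y' = Fin.take j j.isLt.le y := fun j hj => by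
    ext i
    exact hy _ (hD _ j (Fin.le_def.2 i.isLt.le) hj)
  have h1 : ∑ j ∈ D, (B n x j (Fin.take j j.isLt.le y) : Measure Y).real {c | c ≠ y j} ≤
      offlineMistakes B x y' := by
    unfold offlineMistakes
    refine le_trans (Finset.sum_le_sum fun j hj => ?_)
      (Finset.sum_le_sum_of_subset_of_nonneg D.subset_univ fun _ _ _ => measureReal_nonneg)
    rw [htake j hj, hy j hj]
  have h2 : (hypothesisMistakes h x y' : ℝ) = ∑ j ∈ D, if h (x j) ≠ y j then (1 : ℝ) else 0 := by
    rw [Finset.sum_boole, hypothesisMistakes]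
    congr 2
    ext j
    by_cases hj : j ∈ D <;> simp [y', hj]
  rw [Finset.sum_sub_distrib]
  linarith [sub_bestInHindsight_le_offlineRegret B H x y', bestInHindsight_le hH x y']

end Offline

/-! ### Restarting the offline learner on forecasts -/

section Restart

variable {X : Type*}

/-- The rounds in which the offline learner is restarted: the multiples of `k` (so also round
`0`), and the rounds whose example differs from the forecast of the round before. -/
def IsRestart (k : ℕ) {n T : ℕ} (x : Fin n → X) (z : Fin n → (Fin T → X)) (u : ℕ) : Prop :=
  k ∣ u ∨ ∃ (v w : Fin n) (hw : (w : ℕ) < T), (v : ℕ) + 1 = w ∧ (w : ℕ) = u ∧ z v ⟨w, hw⟩ ≠ x w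

open Classical in
/-- The last restart that is not after round `t`. -/
noncomputable def lastRestart (k : ℕ) {n T : ℕ} (x : Fin n → X) (z : Fin n → (Fin T → X))
    (t : ℕ) : ℕ :=
  Nat.findGreatest (IsRestart k x z) t

theorem isRestart_take {k T : ℕ} (x : Fin T → X) (z : Fin T → (Fin T → X)) (t : Fin T) {u : ℕ}
    (hu : u ≤ t) : IsRestart k (Fin.take (t + 1) t.isLt x) (Fin.take (t + 1) t.isLt z) u ↔
      IsRestart k x z u := by
  refine or_congr_right ⟨?_, ?_⟩
  · rintro ⟨v, w, hw, h1, h2, h3⟩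
    exact ⟨Fin.castLE t.isLt v, Fin.castLE t.isLt w, hw, h1, h2, h3⟩
  · rintro ⟨v, w, hw, h1, h2, h3⟩
    exact ⟨⟨v, by omega⟩, ⟨w, by omega⟩, hw, h1, h2, h3⟩

theorem lastRestart_eq_iff {k n T : ℕ} {x : Fin n → X} {z : Fin n → (Fin T → X)} {t s : ℕ} :
    lastRestart k x z t = s ↔
      s ≤ t ∧ IsRestart k x z s ∧ ∀ u, s < u → u ≤ t → ¬ IsRestart k x z u := by
  classical
  rw [lastRestart, Nat.findGreatest_eq_iff]
  refine and_congr_right fun _ => and_congr_left fun _ => ⟨fun h => ?_, fun h _ => h⟩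
  rcases eq_or_ne s 0 with rfl | hs
  · exact Or.inl (dvd_zero k)
  · exact h hs

theorem lastRestart_take {k T : ℕ} (x : Fin T → X) (z : Fin T → (Fin T → X)) (t : Fin T) :
    lastRestart k (Fin.take (t + 1) t.isLt x) (Fin.take (t + 1) t.isLt z) t =
      lastRestart k x z t := by
  obtain ⟨h1, h2, h3⟩ := lastRestart_eq_iff.1 (rfl : lastRestart k x z t = _)
  exact lastRestart_eq_iff.2 ⟨h1, (isRestart_take x z t h1).2 h2, fun u hu hut =>
    mt (isRestart_take x z t hut).1 (h3 u hu hut)⟩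

/-- Number of rounds from `s` to the next multiple of `k` or to the horizon `T`. -/
def stretchLength (k T s : ℕ) : ℕ := min ((s / k + 1) * k) T - s

theorem stretchLength_le {k : ℕ} (hk : 0 < k) (T s : ℕ) : stretchLength k T s ≤ k := by
  have := Nat.lt_div_mul_add hk (a := s)
  have h2 := Nat.div_mul_le_self s k
  rw [stretchLength, add_mul, one_mul]
  omega

theorem lt_add_stretchLength {k T : ℕ} (hk : 0 < k) {n : ℕ} {x : Fin n → X}
    {z : Fin n → (Fin T → X)} {t s : ℕ} (htT : t < T) (hs : lastRestart k x z t = s) :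
    t < s + stretchLength k T s := by
  obtain ⟨h1, -, h3⟩ := lastRestart_eq_iff.1 hs
  have hlt := Nat.lt_div_mul_add hk (a := s)
  have h4 : t < (s / k + 1) * k := by
    by_contra hle
    refine h3 ((s / k + 1) * k) (by rw [add_mul, one_mul]; omega) (by omega)
      (Or.inl (dvd_mul_left _ _))
  rw [stretchLength]
  omega

/-- Forecasts of a consistent and lazy Predictor on the stream `x`. -/
structure IsConsistentLazy {T : ℕ} (x : Fin T → X) (z : Fin T → (Fin T → X)) : Prop where
  consistent : ∀ s t : Fin T, t ≤ s → z s t = x t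
  lazy : ∀ s t : Fin T, (s : ℕ) + 1 = t → z s t = x t → z t = z s

/-- Between restarts the forecast does not change. -/
theorem IsConsistentLazy.eq_of_lastRestart {T k : ℕ} {x : Fin T → X} {z : Fin T → (Fin T → X)}
    (hz : IsConsistentLazy x z) {s t : Fin T} (hs : lastRestart k x z t = s) : z t = z s := by
  obtain ⟨h1, -, h3⟩ := lastRestart_eq_iff.1 hs
  have key : ∀ d (hd : (s : ℕ) + d ≤ t), z ⟨s + d, hd.trans_lt t.isLt⟩ = z s := by
    intro d
    induction d with
    | zero => exact fun _ => rfl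
    | succ d ih =>
      intro hd
      rw [← ih (by omega)]
      refine hz.lazy _ _ rfl ?_
      by_contra hne
      exact h3 (s + (d + 1)) (by omega) hd
        (Or.inr ⟨⟨s + d, by omega⟩, ⟨s + (d + 1), hd.trans_lt t.isLt⟩, hd.trans_lt t.isLt,
          rfl, rfl, hne⟩)
  have h4 := key (t - s) (by omega)
  rwa [show (⟨s + (t - s), (by omega : (s : ℕ) + (t - s) < T)⟩ : Fin T) = t from
    Fin.ext (by simp only; omega)] at h4

variable {Y : Type*} [MeasurableSpace Y]

/-- Run the offline learner on the rounds `s, …, s + n - 1` of the forecast made in round `s`. The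
prediction in all other rounds is arbitrary. -/
noncomputable def runFrom [Nonempty Y] (B : OfflineLearner X Y) (T s n : ℕ) :
    OnlineLearner X Y T := fun t _ y z =>
  if h : s ≤ t ∧ t < s + n ∧ s + n ≤ T then
    B n (fun i : Fin n => z ⟨s, by omega⟩ ⟨s + i, by omega⟩) ⟨t - s, by omega⟩
      (fun i : Fin (t - s) => y ⟨s + i, by omega⟩)
  else diracProba (Classical.arbitrary Y)

theorem roundLoss_runFrom [Nonempty Y] (B : OfflineLearner X Y) {T s n : ℕ} (x : Fin T → X)
    (y : Fin T → Y) (z : Fin T → (Fin T → X)) (t : Fin T)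
    (h : s ≤ t ∧ t < s + n ∧ s + n ≤ T) :
    roundLoss (runFrom B T s n) x y z t =
      (B n (fun i : Fin n => z ⟨s, by omega⟩ ⟨s + i, by omega⟩) ⟨t - s, by omega⟩
        (fun i : Fin (t - s) => y ⟨s + i, by omega⟩) : Measure Y).real {c | c ≠ y t} := by
  rw [roundLoss, runFrom, dif_pos h]
  rfl

/-- The expert that restarts the offline learner in each round with `IsRestart k`, initialized with
the current forecast up to the next multiple of `k`. -/
noncomputable def restartExpert [Nonempty Y] (B : OfflineLearner X Y) (k T : ℕ) :
    OnlineLearner X Y T := fun t x y z =>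
  runFrom B T (lastRestart k x z t) (stretchLength k T (lastRestart k x z t)) t x y z

theorem roundLoss_restartExpert [Nonempty Y] (B : OfflineLearner X Y) (k : ℕ) {T : ℕ}
    (x : Fin T → X) (y : Fin T → Y) (z : Fin T → (Fin T → X)) (t : Fin T) :
    roundLoss (restartExpert B k T) x y z t = roundLoss
      (runFrom B T (lastRestart k x z t) (stretchLength k T (lastRestart k x z t))) x y z t := by
  rw [roundLoss, restartExpert, lastRestart_take]
  rfl

open Classical in
/-- Excess loss of the expert between two consecutive restarts. -/
theorem stretch_excess_le [Nonempty Y] (B : OfflineLearner X Y) {H : Set (X → Y)} {h : X → Y}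
    (hH : h ∈ H) {k T : ℕ} (hk : 0 < k) (x : Fin T → X) (y : Fin T → Y) {z : Fin T → (Fin T → X)}
    (hz : IsConsistentLazy x z) (s : Fin T) :
    ∑ t ∈ Finset.univ.filter fun t : Fin T => lastRestart k x z t = s,
      (roundLoss (restartExpert B k T) x y z t - if h (x t) ≠ y t then 1 else 0) ≤
        offlineRegret B H (stretchLength k T s) := by
  set n := stretchLength k T s with hn
  have hsn : (s : ℕ) + n ≤ T := by
    have := s.isLt
    rw [hn, stretchLength]
    omega
  let e : Fin n → Fin T := fun i => ⟨s + i, by omega⟩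
  refine le_of_eq_of_le ?_ (initial_excess_le_offlineRegret B hH (fun i => z s (e i))
    (fun i => y (e i)) (Finset.univ.filter fun i => lastRestart k x z (e i) = s) ?_)
  · symm
    refine Finset.sum_bij (fun i _ => e i) (fun i hi => by simpa using hi)
      (fun a _ b _ hab => ?_) (fun t ht => ?_) (fun i hi => ?_)
    · have := congrArg Fin.val hab
      exact Fin.ext (by simpa [e] using this)
    · have ht : lastRestart k x z t = s := by simpa using ht
      have h1 := (lastRestart_eq_iff.1 ht).1
      have h2 := lt_add_stretchLength hk t.isLt ht
      have he : e ⟨t - s, by omega⟩ = t := Fin.ext (by simp only [e]; omega)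
      exact ⟨⟨t - s, by omega⟩, by simp [he, ht], he⟩
    · have hi : lastRestart k x z (e i) = s := by simpa using hi
      have h1 : z s (e i) = x (e i) := by
        rw [← hz.eq_of_lastRestart hi]
        exact hz.consistent _ _ le_rfl
      have h2 : e i - s = (i : ℕ) := by simp [e]
      have h3 : (s : ℕ) ≤ e i ∧ e i < s + n ∧ (s : ℕ) + n ≤ T := ⟨by simp [e], by simp [e], hsn⟩
      rw [roundLoss_restartExpert, hi, roundLoss_runFrom B x y z (e i) h3, h1]
      congr 1
      have h4 : ∀ j (hj : j < n), j = (i : ℕ) →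
          (B n (fun i => z s (e i)) i (Fin.take i i.isLt.le fun i => y (e i)) :
            Measure Y).real {c | c ≠ y (e i)} =
          (B n (fun i => z s (e i)) ⟨j, hj⟩ (fun l : Fin j => y ⟨s + l, by omega⟩) :
            Measure Y).real {c | c ≠ y (e i)} := by
        rintro _ _ rfl
        rfl
      exact h4 _ _ h2
  · intro i j hij hj
    have hj : lastRestart k x z (e j) = s := by simpa using hj
    obtain ⟨-, h2, h3⟩ := lastRestart_eq_iff.1 hj
    have hij' : (e i : ℕ) ≤ e j := Nat.add_le_add_left (Fin.le_def.1 hij) _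
    simpa using lastRestart_eq_iff.2
      ⟨Nat.le_add_right _ _, h2, fun u hu hui => h3 u hu (hui.trans hij')⟩

open Classical in
theorem card_multiples_le (k T : ℕ) :
    ((Finset.range T).filter (k ∣ ·)).card ≤ T / k + 1 := by
  rw [← Finset.card_range (T / k + 1)]
  refine Finset.card_le_card_of_injOn (· / k) (fun u hu => ?_) (fun a ha b hb hab => ?_)
  · simp only [Finset.coe_filter, Finset.mem_range, Set.mem_ofPred_eq] at hu
    simpa using Nat.lt_succ_of_le (Nat.div_le_div_right hu.1.le)
  · simp only [Finset.coe_filter, Finset.mem_range, Set.mem_ofPred_eq] at ha hb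
    rw [← Nat.div_mul_cancel ha.2, ← Nat.div_mul_cancel hb.2]
    exact congrArg (· * k) hab

open Classical in
theorem card_restarts_le (k : ℕ) {T : ℕ} (x : Fin T → X) (z : Fin T → (Fin T → X)) :
    (Finset.univ.filter fun t : Fin T => IsRestart k x z t).card ≤ T / k + 1 +
      (Finset.univ.filter fun t : Fin T =>
        ∃ s : Fin T, (s : ℕ) + 1 = t ∧ z s t ≠ x t).card := by
  have hsub : (Finset.univ.filter fun t : Fin T => IsRestart k x z t) ⊆
      (Finset.univ.filter fun t : Fin T => k ∣ (t : ℕ)) ∪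
      Finset.univ.filter fun t : Fin T => ∃ s : Fin T, (s : ℕ) + 1 = t ∧ z s t ≠ x t := by
    intro t ht
    rcases (Finset.mem_filter.1 ht).2 with h | ⟨v, w, hw, h1, h2, h3⟩
    · exact Finset.mem_union_left _ (Finset.mem_filter.2 ⟨Finset.mem_univ _, h⟩)
    · obtain rfl : w = t := Fin.ext h2
      exact Finset.mem_union_right _ (Finset.mem_filter.2 ⟨Finset.mem_univ _, v, h1, h3⟩)
  have h1 : (Finset.univ.filter fun t : Fin T => k ∣ (t : ℕ)).card ≤
      ((Finset.range T).filter (k ∣ ·)).card :=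
    Finset.card_le_card_of_injOn (fun t => (t : ℕ)) (fun t ht => by simpa using ht)
      fun a _ b _ hab => Fin.ext hab
  have h2 := (Finset.card_le_card hsub).trans (Finset.card_union_le _ _)
  have h3 := card_multiples_le k T
  omega

open Classical in
theorem onlineMistakes_restartExpert_le [Nonempty Y] (B : OfflineLearner X Y) {H : Set (X → Y)}
    {h : X → Y} (hH : h ∈ H) {k T : ℕ} (hk : 0 < k) (x : Fin T → X) (y : Fin T → Y)
    {z : Fin T → (Fin T → X)} (hz : IsConsistentLazy x z) {r : ℝ} (hr : 0 ≤ r)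
    (hBr : ∀ n ≤ k, offlineRegret B H n ≤ r) :
    onlineMistakes (restartExpert B k T) x y z ≤ hypothesisMistakes h x y +
      (((T / k : ℕ) : ℝ) + 1 + (Finset.univ.filter fun t : Fin T =>
        ∃ s : Fin T, (s : ℕ) + 1 = t ∧ z s t ≠ x t).card) * r := by
  set f : Fin T → ℝ := fun t => roundLoss (restartExpert B k T) x y z t -
      if h (x t) ≠ y t then 1 else 0 with hf
  let g : Fin T → Fin T := fun t =>
    ⟨lastRestart k x z t, (lastRestart_eq_iff.1 rfl).1.trans_lt t.isLt⟩
  have h1 : onlineMistakes (restartExpert B k T) x y z = hypothesisMistakes h x y + ∑ t, f t := by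
    have : (hypothesisMistakes h x y : ℝ) = ∑ t, if h (x t) ≠ y t then (1 : ℝ) else 0 := by
      rw [Finset.sum_boole, hypothesisMistakes]
    rw [this, ← Finset.sum_add_distrib, onlineMistakes_eq_sum]
    simp [hf]
  have h2 : ∑ t, f t ≤ (Finset.univ.filter fun t : Fin T => IsRestart k x z t).card * r := by
    rw [← Finset.sum_fiberwise_of_maps_to (g := g)
      (t := Finset.univ.filter fun t : Fin T => IsRestart k x z t) (fun t _ =>
        Finset.mem_filter.2 ⟨Finset.mem_univ _, (lastRestart_eq_iff.1 rfl).2.1⟩), ← nsmul_eq_mul]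
    refine Finset.sum_le_card_nsmul _ _ _ fun s _ => ?_
    have h3 := stretch_excess_le B hH hk x y hz s
    simp only [g, Fin.ext_iff]
    exact h3.trans (hBr _ (stretchLength_le hk T s))
  rw [h1]
  have h3 : ((Finset.univ.filter fun t : Fin T => IsRestart k x z t).card : ℝ) ≤ _ :=
    Nat.cast_le.2 (card_restarts_le k x z)
  push_cast at h3
  have h4 := mul_le_mul_of_nonneg_right h3 hr
  linarith

/-! ### Measurability in the randomness of the Predictor -/

variable {Ω : Type*} [MeasurableSpace Ω] {μ : Measure Ω}

theorem measurableSet_forecast_ne {T : ℕ} (P : Predictor μ X T) (x : Fin T → X) (s t : Fin T) :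
    MeasurableSet {ω | P.forecastOn x ω s t ≠ x t} :=
  (P.measurableSet_correct x s t).compl

theorem measurable_lastRestart {T : ℕ} (P : Predictor μ X T) (x : Fin T → X) (k t : ℕ) :
    Measurable fun ω => lastRestart k x (P.forecastOn x ω) t := by
  classical
  unfold lastRestart
  refine measurable_findGreatest fun u _ => ?_
  unfold IsRestart
  simp only [Set.ofPred_or, Set.ofPred_exists, Set.ofPred_and]
  refine (MeasurableSet.const _).union ?_
  refine .iUnion fun v => .iUnion fun w => .iUnion fun hw => ?_
  exact (MeasurableSet.const _).inter ((MeasurableSet.const _).inter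
    (measurableSet_forecast_ne P x v w))

theorem measurable_apply_index {g : ℕ → Ω → ℝ} (hg : ∀ n, Measurable (g n)) {σ : Ω → ℕ}
    (hσ : Measurable σ) : Measurable fun ω => g (σ ω) ω := by
  have h : Measurable fun p : Ω × ℕ => g p.2 p.1 := measurable_from_prod_countable_left hg
  exact h.comp (measurable_id.prodMk hσ)

theorem measurable_roundLoss_runFrom [MeasurableSingletonClass Y] [Nonempty Y] {T : ℕ}
    (P : Predictor μ X T) (B : OfflineLearner X Y) (hPB : P.IsMeasurableFor B) (x : Fin T → X)
    (y : Fin T → Y) (s n : ℕ) (t : Fin T) :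
    Measurable fun ω => roundLoss (runFrom B T s n) x y (P.forecastOn x ω) t := by
  by_cases h : s ≤ t ∧ t < s + n ∧ s + n ≤ T
  · have hc : ∀ ν : ProbabilityMeasure Y,
        (ν : Measure Y).real {c | c ≠ y t} = 1 - ((ν : Measure Y) {y t}).toReal := fun ν =>
      probReal_compl_eq_one_sub (measurableSet_singleton (y t))
    simp only [roundLoss_runFrom B x y _ t h, hc]
    exact (hPB x ⟨s, by omega⟩ n h.2.2 ⟨t - s, by omega⟩ _ (y t)).ennreal_toReal.const_sub 1
  · have hd : ∀ ω, roundLoss (runFrom B T s n) x y (P.forecastOn x ω) t =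
        (diracProba (Classical.arbitrary Y) : Measure Y).real {c | c ≠ y t} := fun ω => by
      rw [roundLoss, runFrom, dif_neg h]
    simp only [hd]
    exact measurable_const

theorem measurable_roundLoss_restartExpert [MeasurableSingletonClass Y] [Nonempty Y] {T : ℕ}
    (P : Predictor μ X T) (B : OfflineLearner X Y) (hPB : P.IsMeasurableFor B) (k : ℕ)
    (x : Fin T → X) (y : Fin T → Y) (t : Fin T) :
    Measurable fun ω => roundLoss (restartExpert B k T) x y (P.forecastOn x ω) t := by
  simp only [roundLoss_restartExpert]
  exact measurable_apply_index
    (fun s => measurable_roundLoss_runFrom P B hPB x y s (stretchLength k T s) t)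
    (measurable_lastRestart P x k t)

theorem Predictor.ae_isConsistentLazy {T : ℕ} (P : Predictor μ X T) (x : Fin T → X) :
    ∀ᵐ ω ∂μ, IsConsistentLazy x (P.forecastOn x ω) := by
  have h1 : ∀ᵐ ω ∂μ, ∀ s t : Fin T, t ≤ s → P.forecastOn x ω s t = x t := by
    simp only [ae_all_iff]
    exact fun s t h => P.consistent x s t h
  have h2 : ∀ᵐ ω ∂μ, ∀ s t : Fin T, (s : ℕ) + 1 = t → P.forecastOn x ω s t = x t →
      P.forecastOn x ω t = P.forecastOn x ω s := by
    simp only [ae_all_iff]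
    exact fun s t h => P.lazy x s t h
  filter_upwards [h1, h2] with ω h1 h2 using ⟨h1, h2⟩

theorem Predictor.integrable_mistakes [IsProbabilityMeasure μ] {T : ℕ} (P : Predictor μ X T)
    (x : Fin T → X) : Integrable (fun ω => (P.mistakes x ω : ℝ)) μ := by
  classical
  refine Integrable.of_mem_Icc 0 T ?_ (ae_of_all _ fun ω => ⟨Nat.cast_nonneg _, ?_⟩)
  · have h : ∀ ω, (P.mistakes x ω : ℝ) = ∑ t : Fin T,
        if ∃ s : Fin T, (s : ℕ) + 1 = t ∧ P.forecastOn x ω s t ≠ x t then (1 : ℝ) else 0 :=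
      fun ω => by
        rw [Finset.sum_boole, Predictor.mistakes]
    simp only [h]
    refine (Finset.measurable_sum _ fun t _ => Measurable.ite ?_ measurable_const
      measurable_const).aemeasurable
    simp only [Set.ofPred_exists, Set.ofPred_and]
    exact MeasurableSet.iUnion fun s =>
      (MeasurableSet.const _).inter (measurableSet_forecast_ne P x s t)
  · unfold Predictor.mistakes
    exact_mod_cast (Finset.card_le_univ _).trans (by simp)

end Restart

/-! ### Real inequalities -/

theorem ConcaveOn.monotoneOn_of_nonneg {f : ℝ → ℝ} (hf : ConcaveOn ℝ (Set.Ici 0) f)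
    (h0 : ∀ u, 0 ≤ u → 0 ≤ f u) : MonotoneOn f (Set.Ici 0) := by
  intro a ha b hb hab
  by_contra! hlt
  have hab' : a < b := lt_of_le_of_ne hab fun h => by simp [h] at hlt
  rw [Set.mem_Ici] at ha hb
  have hfb := h0 b hb
  have hd : 0 < f a - f b := sub_pos.2 hlt
  have hba : 0 < b - a := sub_pos.2 hab'
  -- The chord through `a` and `b` falls to `-1` at `b + D`.
  set D := (f b + 1) * (b - a) / (f a - f b) with hD
  have hDpos : 0 < D := by positivity
  have h := hf.slope_anti_adjacent (x := a) (y := b) (z := b + D) ha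
    (Set.mem_Ici.2 (by positivity)) hab' (by linarith)
  rw [add_sub_cancel_left, div_le_div_iff₀ hDpos hba] at h
  have h1 : (f b - f a) * D = -((f b + 1) * (b - a)) := by
    rw [hD]
    field_simp
    ring
  have h2 := h0 (b + D) (by positivity)
  nlinarith

theorem sqrt_mul_log_two_div_two_le (T : ℝ) : √(T * Real.log 2 / 2) ≤ √T := by
  rcases le_or_gt 0 T with hT | hT
  · refine Real.sqrt_le_sqrt ?_
    nlinarith [Real.log_two_lt_d9]
  · rw [Real.sqrt_eq_zero_of_nonpos]
    · positivity
    · nlinarith [Real.log_two_gt_d9]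

theorem sqrt_mul_log_div_two_le {T : ℝ} (hT : 1 ≤ T) :
    √(T * Real.log T / 2) ≤ √(T * Real.logb 2 T) := by
  refine Real.sqrt_le_sqrt ?_
  rw [mul_div_assoc]
  refine mul_le_mul_of_nonneg_left ?_ (by linarith)
  exact div_le_div_of_nonneg_left (Real.log_nonneg hT) (by linarith [Real.log_two_gt_d9])
    (by linarith [Real.log_two_lt_d9])

/-- The additive loss `L` fits into the gap between natural and binary logarithms unless
`L log₂ (e T) ≥ T`, in which case the bound is trivial. -/
theorem le_sqrt_mul_logb_add_sqrt {L T : ℕ} (hT : 1 ≤ T) {r : ℝ} (hrT : r ≤ T)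
    (hr : r ≤ L + √(T * (L * Real.log (T + 1)) / 2) + √(T * Real.log 2 / 2)) :
    r ≤ √(L * T * Real.logb 2 (Real.exp 1 * T)) + √T := by
  have h0 := sqrt_mul_log_two_div_two_le T
  rcases L.eq_zero_or_pos with rfl | hL
  · simp only [CharP.cast_eq_zero, zero_mul, mul_zero, zero_div, Real.sqrt_zero, zero_add] at hr ⊢
    linarith
  rcases hT.eq_or_lt with rfl | hT2
  · simp only [Nat.cast_one, Real.sqrt_one] at hrT ⊢
    linarith [Real.sqrt_nonneg (L * 1 * Real.logb 2 (Real.exp 1 * 1))]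
  set a := Real.logb 2 (Real.exp 1 * T) with ha
  have hT2' : (2 : ℝ) ≤ T := by exact_mod_cast hT2
  have hL' : (1 : ℝ) ≤ L := by exact_mod_cast hL
  have hlog2 : 0 < Real.log 2 := Real.log_pos (by norm_num)
  have halog : a * Real.log 2 = Real.log (Real.exp 1 * T) :=
    div_mul_cancel₀ _ hlog2.ne'
  have hlogT : Real.log 2 ≤ Real.log T := Real.log_le_log (by norm_num) hT2'
  have ha2 : 2.44 ≤ a := by
    have h1 : Real.log (Real.exp 1 * T) = 1 + Real.log T := by
      rw [Real.log_mul (Real.exp_pos 1).ne' (by positivity), Real.log_exp]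
    rw [h1] at halog
    have := Real.log_two_lt_d9
    by_contra! hlt
    nlinarith
  rcases le_or_gt (T : ℝ) (L * a) with hcase | hcase
  · have h1 : (T : ℝ) ≤ √(L * T * a) := Real.le_sqrt_of_sq_le (by nlinarith)
    linarith [Real.sqrt_nonneg (T : ℝ)]
  -- The two losses take the shares `0.411` and `0.589` of the bound; the second is just above
  -- `√(log 2 / 2)`, and the first needs `0.411 * a ≥ 1`, which holds from `T = 2` on.
  · have hLTa : 0 ≤ (L : ℝ) * T * a := by positivity
    have h1 : (L : ℝ) ≤ 0.411 * √(L * T * a) := by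
      have h : (L : ℝ) ^ 2 ≤ 0.411 ^ 2 * (L * T * a) := by
        have h2 : (L : ℝ) ≤ 0.411 ^ 2 * (T * a) := by
          have h3 : L * a * a ≤ T * a := mul_le_mul_of_nonneg_right hcase.le (by linarith)
          have h4 : (2.44 ^ 2 : ℝ) ≤ a ^ 2 := by gcongr
          nlinarith
        nlinarith
      calc (L : ℝ) ≤ √(0.411 ^ 2 * (L * T * a)) := Real.le_sqrt_of_sq_le h
        _ = _ := by rw [Real.sqrt_mul (by norm_num), Real.sqrt_sq (by norm_num)]
    have h2 : √(T * (L * Real.log (T + 1)) / 2) ≤ 0.589 * √(L * T * a) := by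
      have hlog : Real.log (T + 1) ≤ a * Real.log 2 := by
        rw [halog]
        refine Real.log_le_log (by positivity) ?_
        nlinarith [Real.add_one_le_exp (1 : ℝ)]
      calc √(T * (L * Real.log (T + 1)) / 2) ≤ √(0.589 ^ 2 * (L * T * a)) := by
            refine Real.sqrt_le_sqrt ?_
            have h3 : T * (L * Real.log (T + 1)) ≤ T * (L * (a * Real.log 2)) := by gcongr
            have h4 := mul_le_mul_of_nonneg_left Real.log_two_lt_d9.le hLTa
            linarith
        _ = _ := by rw [Real.sqrt_mul (by norm_num), Real.sqrt_sq (by norm_num)]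
    linarith

/-! ### The combined learner -/

section Combined

variable {X Y Ω : Type*} [MeasurableSpace Y] [MeasurableSpace Ω] {μ : Measure Ω}

/-- Exponential weights over the restart periods `1, …, T`. -/
noncomputable def restartLearner [Nonempty Y] (B : OfflineLearner X Y) (T : ℕ) [NeZero T] :
    OnlineLearner X Y T :=
  hedge fun k : Fin T => restartExpert B (k + 1) T

/-- Exponential weights over the agnostic learner for a finite Littlestone dimension and the learner
that follows the Predictor. -/
noncomputable def combinedLearner [Nonempty Y] (B : OfflineLearner X Y) (H : Set (X → Y))
    (T : ℕ) [NeZero T] : OnlineLearner X Y T :=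
  hedge fun b : Bool => match b with
    | true => soaLearner H (littlestoneDim H).toNat T
    | false => restartLearner B T

theorem expectedRegret_le_of_forall {T : ℕ} {A : OnlineLearner X Y T}
    {P : Predictor μ X T} {H : Set (X → Y)} (hH : H.Nonempty) {x : Fin T → X} {y : Fin T → Y}
    {c : ℝ}
    (h : ∀ h ∈ H, ∫ ω, onlineMistakes A x y (P.forecastOn x ω) ∂μ ≤ hypothesisMistakes h x y + c) :
    expectedRegret A P H x y ≤ c := by
  have : Nonempty H := hH.to_subtype
  have h1 : ∫ ω, onlineMistakes A x y (P.forecastOn x ω) ∂μ - c ≤ bestInHindsight H x y :=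
    le_ciInf fun g => by linarith [h g.1 g.2]
  rw [expectedRegret]
  linarith

theorem expectedRegret_le_horizon [IsProbabilityMeasure μ] {T : ℕ} {A : OnlineLearner X Y T}
    {P : Predictor μ X T} {H : Set (X → Y)} {x : Fin T → X} {y : Fin T → Y}
    (hA : Integrable (fun ω => onlineMistakes A x y (P.forecastOn x ω)) μ) :
    expectedRegret A P H x y ≤ T := by
  have h1 := integral_mono (μ := μ) hA (integrable_const (T : ℝ)) fun ω =>
    onlineMistakes_le A x y (P.forecastOn x ω)
  simp only [integral_const, probReal_univ, one_smul] at h1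
  rw [expectedRegret]
  linarith [bestInHindsight_nonneg H x y]

variable [MeasurableSingletonClass Y] [Nonempty Y]

theorem integrable_combinedLearner [IsProbabilityMeasure μ] {T : ℕ} [NeZero T]
    (P : Predictor μ X T) (B : OfflineLearner X Y) (hPB : P.IsMeasurableFor B) (H : Set (X → Y))
    (x : Fin T → X) (y : Fin T → Y) :
    Integrable (fun ω => onlineMistakes (combinedLearner B H T) x y (P.forecastOn x ω)) μ := by
  refine integrable_onlineMistakes μ _ x y _ fun t => ?_
  refine measurable_roundLoss_hedge _ x y _ (fun b t => ?_) t
  cases b with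
  | true => exact measurable_roundLoss_soaLearner _ _ x y _ t
  | false =>
    exact measurable_roundLoss_hedge _ x y _
      (fun k t => measurable_roundLoss_restartExpert P B hPB _ x y t) t

theorem expectedRegret_combinedLearner_le_littlestone [IsProbabilityMeasure μ] {T : ℕ} [NeZero T]
    (P : Predictor μ X T) (B : OfflineLearner X Y) (hPB : P.IsMeasurableFor B) {H : Set (X → Y)}
    (hH : H.Nonempty) {L : ℕ} (hL : littlestoneDim H = L) (x : Fin T → X) (y : Fin T → Y) :
    expectedRegret (combinedLearner B H T) P H x y ≤
      √(L * T * Real.logb 2 (Real.exp 1 * T)) + √T := by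
  have hint := integrable_combinedLearner P B hPB H x y
  refine le_sqrt_mul_logb_add_sqrt NeZero.one_le (expectedRegret_le_horizon hint) ?_
  refine expectedRegret_le_of_forall hH fun h hh => ?_
  have hω : ∀ ω, onlineMistakes (combinedLearner B H T) x y (P.forecastOn x ω) ≤
      hypothesisMistakes h x y + (L + √(T * (L * Real.log (T + 1)) / 2) + √(T * Real.log 2 / 2)) :=
    fun ω => by
      have h1 : onlineMistakes (combinedLearner B H T) x y (P.forecastOn x ω) ≤ _ :=
        onlineMistakes_hedge_le _ x y _ true
      have h2 := onlineMistakes_soaLearner_le (not_shattersDepth_succ hL) x y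
        (P.forecastOn x ω) hh
      simp only [hL, ENat.toNat_natCast, Fintype.card_bool, Nat.cast_ofNat] at h1
      linarith
  have h3 := integral_mono (μ := μ) hint (integrable_const _) hω
  simpa only [integral_const, probReal_univ, one_smul] using h3

theorem expectedRegret_combinedLearner_le_forecast [IsProbabilityMeasure μ] {T : ℕ} [NeZero T]
    (P : Predictor μ X T) (B : OfflineLearner X Y) (hPB : P.IsMeasurableFor B) {H : Set (X → Y)}
    (hH : H.Nonempty) {Rbar : ℝ → ℝ} (hR : IsConcaveMajorant (offlineRegret B H) Rbar)
    (x : Fin T → X) (y : Fin T → Y) :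
    expectedRegret (combinedLearner B H T) P H x y ≤
      2 * (P.expectedMistakes x + 1) * Rbar (T / (P.expectedMistakes x + 1) + 1) +
        √(T * Real.logb 2 T) + √T := by
  have hint := integrable_combinedLearner P B hPB H x y
  have hT : (1 : ℝ) ≤ T := by exact_mod_cast (NeZero.one_le : 1 ≤ T)
  set M := P.expectedMistakes x with hM
  have hM0 : 0 ≤ M := integral_nonneg fun ω => Nat.cast_nonneg _
  have hM1 : 0 < M + 1 := by linarith
  -- The restart period that balances the two causes of restarts.
  set k := ⌈(T : ℝ) / (M + 1)⌉₊ with hk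
  have hdiv : 0 < (T : ℝ) / (M + 1) := by positivity
  have hkpos : 0 < k := Nat.ceil_pos.2 hdiv
  have hkT : k ≤ T := Nat.ceil_le.2 (div_le_self (by linarith) (by linarith))
  have hkle : (k : ℝ) ≤ T / (M + 1) + 1 := (Nat.ceil_lt_add_one hdiv.le).le
  have hTk : ((T / k : ℕ) : ℝ) ≤ M + 1 := by
    refine Nat.cast_div_le.trans ?_
    rw [div_le_iff₀ (by exact_mod_cast hkpos), mul_comm, ← div_le_iff₀ hM1]
    exact Nat.le_ceil _
  set r := Rbar (T / (M + 1) + 1) with hr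
  have hr0 : 0 ≤ r := hR.nonneg _ (by positivity)
  have hBr : ∀ n ≤ k, offlineRegret B H n ≤ r := fun n hn =>
    (hR.le n).trans (hR.concave.monotoneOn_of_nonneg hR.nonneg (Set.mem_Ici.2 (Nat.cast_nonneg n))
      (Set.mem_Ici.2 (by positivity)) (le_trans (Nat.cast_le.2 hn) hkle))
  refine expectedRegret_le_of_forall hH fun h hh => ?_
  set c := √(T * Real.log T / 2) + √(T * Real.log 2 / 2) with hc
  have hω : ∀ᵐ ω ∂μ, onlineMistakes (combinedLearner B H T) x y (P.forecastOn x ω) ≤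
      hypothesisMistakes h x y + (((T / k : ℕ) : ℝ) + 1) * r + c + P.mistakes x ω * r := by
    filter_upwards [P.ae_isConsistentLazy x] with ω hz
    have h1 : onlineMistakes (combinedLearner B H T) x y (P.forecastOn x ω) ≤ _ :=
      onlineMistakes_hedge_le _ x y _ false
    have h2 : onlineMistakes (restartLearner B T) x y (P.forecastOn x ω) ≤ _ :=
      onlineMistakes_hedge_le _ x y _ ⟨k - 1, by omega⟩
    have h3 := onlineMistakes_restartExpert_le B hh hkpos x y hz hr0 hBr
    simp only [Fintype.card_bool, Fintype.card_fin, Nat.cast_ofNat,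
      Nat.sub_add_cancel hkpos] at h1 h2
    rw [Predictor.mistakes]
    rw [add_mul] at h3
    linarith
  have hmint := P.integrable_mistakes x
  have h4 := integral_mono_ae (μ := μ) hint
    ((integrable_const _).add (hmint.mul_const r)) hω
  simp only [Pi.add_apply] at h4
  rw [integral_add (integrable_const _) (hmint.mul_const r), integral_mul_const] at h4
  simp only [integral_const, probReal_univ, one_smul] at h4
  have h5 : ∫ ω, (P.mistakes x ω : ℝ) ∂μ = M := rfl
  rw [h5] at h4
  have h6 := sqrt_mul_log_two_div_two_le T
  have h7 := sqrt_mul_log_div_two_le hT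
  have h8 : (((T / k : ℕ) : ℝ) + 1) * r ≤ (M + 1 + 1) * r := by gcongr
  linarith

theorem expectedRegret_combinedLearner_le [IsProbabilityMeasure μ] {T : ℕ} [NeZero T]
    (P : Predictor μ X T) (B : OfflineLearner X Y) (hPB : P.IsMeasurableFor B) {H : Set (X → Y)}
    (hH : H.Nonempty) {Rbar : ℝ → ℝ} (hR : IsConcaveMajorant (offlineRegret B H) Rbar)
    (x : Fin T → X) (y : Fin T → Y) :
    ((expectedRegret (combinedLearner B H T) P H x y : ℝ) : EReal) ≤
      min (littlestoneTerm (littlestoneDim H) T)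
        ((2 * (P.expectedMistakes x + 1) * Rbar (T / (P.expectedMistakes x + 1) + 1)
          + √(T * Real.logb 2 T) : ℝ) : EReal)
      + ((√(T : ℝ) : ℝ) : EReal) := by
  rcases min_choice (littlestoneTerm (littlestoneDim H) T)
    ((2 * (P.expectedMistakes x + 1) * Rbar (T / (P.expectedMistakes x + 1) + 1)
      + √(T * Real.logb 2 T) : ℝ) : EReal) with hmin | hmin <;> rw [hmin]
  · cases hL : littlestoneDim H with
    | top =>
      change _ ≤ (⊤ : EReal) + _
      rw [EReal.top_add_coe]
      exact le_top
    | coe L =>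
      exact EReal.coe_le_coe_iff.2
        (expectedRegret_combinedLearner_le_littlestone P B hPB hH hL x y)
  · exact EReal.coe_le_coe_iff.2 (expectedRegret_combinedLearner_le_forecast P B hPB hH hR x y)

end Combined

theorem mainTheorem5 {X Y Ω : Type*} [MeasurableSpace Y] [MeasurableSingletonClass Y]
    [MeasurableSpace Ω] (μ : Measure Ω) [IsProbabilityMeasure μ]
    (H : Set (X → Y)) (hH : H.Nonempty)
    (P : (T : ℕ) → Predictor μ X T)
    (B : OfflineLearner X Y) (hB : IsNoRegret B H)
    (hPB : ∀ T, (P T).IsMeasurableFor B) :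
    ∃ A : (T : ℕ) → OnlineLearner X Y T,
      ∀ (T : ℕ), 1 ≤ T → ∀ (x : Fin T → X) (y : Fin T → Y),
        Integrable (fun ω => onlineMistakes (A T) x y ((P T).forecastOn x ω)) μ ∧
        ∀ Rbar : ℝ → ℝ, IsConcaveMajorant (offlineRegret B H) Rbar →
          ((expectedRegret (A T) (P T) H x y : ℝ) : EReal) ≤
            min (littlestoneTerm (littlestoneDim H) T)
              ((2 * ((P T).expectedMistakes x + 1) *
                  Rbar (T / ((P T).expectedMistakes x + 1) + 1)
                + √(T * Real.logb 2 T) : ℝ) : EReal)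
            + ((√(T : ℝ) : ℝ) : EReal) := by
  obtain ⟨h₀, hh₀⟩ := hH
  rcases isEmpty_or_nonempty Y with hY | hY
  · -- Without labels there are no examples either, hence no streams of positive length.
    exact ⟨fun T t x => (hY.false (h₀ (x 0))).elim,
      fun T hT x => (hY.false (h₀ (x ⟨0, hT⟩))).elim⟩
  refine ⟨fun T => match T with
    | 0 => fun t => t.elim0
    | T + 1 => combinedLearner B H (T + 1), fun T hT x y => ?_⟩
  obtain ⟨T, rfl⟩ := Nat.exists_eq_succ_of_ne_zero (Nat.one_le_iff_ne_zero.1 hT)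
  exact ⟨integrable_combinedLearner (P (T + 1)) B (hPB _) H x y, fun Rbar hR =>
    expectedRegret_combinedLearner_le (P (T + 1)) B (hPB _) ⟨h₀, hh₀⟩ hR x y⟩
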